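/- Let $p$ be an odd prime, let $a$ be a positive integer, let $m$ be an integer with $p\nmid m$, set $\Delta=m(m-4)$, and let $h\in\mathbb Z_p$ be a $p$-adic integer. Let $\left(\frac{\cdot}{\cdot}\right)$ denote the Jacobi symbol (with $\left(\frac{x}{1}\right)=1$ for all $x$), let $\binom{x}{k}=\frac{x(x-1)\cdots(x-k+1)}{k!}$, and let $u_n=u_n(m-2,1)$ be the Lucas sequence given by $u_0=0$, $u_1=1$ and $u_{n+1}=(m-2)u_n-u_{n-1}$ for $n\ge 1$. Congruences modulo $p^2$ are congruences in $\mathbb Z_p$. Then $$\sum_{k=0}^{p^a-1}\binom{hp^a-1}{k}\frac{\binom{2k}{k}}{(-m)^k}\equiv\left(\frac{\Delta}{p^{a-1}}\right)\left(1-\frac{hm}{2}\right)u_{p-\left(\frac{\Delta}{p}\right)}(m-2,1)+\left(\frac{\Delta}{p^a}\right)\left(1+h\left((m-4)^{p-1}-1\right)\right)-\varepsilon\pmod{p^2},$$ where $\varepsilon=h(m-4)$ if $p^a=3$ and $3\mid m-1$, and $\varepsilon=0$ otherwise. In particular, if $hm\equiv 2\pmod p$, then $$\sum_{k=0}^{p^a-1}\binom{hp^a-1}{k}\frac{\binom{2k}{k}}{(-m)^k}\equiv\left(\frac{\Delta}{p^a}\right)\left(1+h\left((m-4)^{p-1}-1\right)\right)+\varepsilon'\pmod{p^2},$$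 where $\varepsilon'=m-4$ if $p^a=3$ and $3\mid m-1$, and $\varepsilon'=0$ otherwise. -/

import Mathlib

/-- The Lucas sequence `u_n(A, B)`: `u_0 = 0`, `u_1 = 1`, `u_{n+1} = A u_n - B u_{n-1}`. -/
def lucasU (A B : ℤ) : ℕ → ℤ
  | 0 => 0
  | 1 => 1
  | n + 2 => A * lucasU A B (n + 1) - B * lucasU A B n

/-- Congruence modulo `p ^ n`: `x - y` lies in `p ^ n ℤ_p`. The quotients occurring in `x` and `y`
are formed in the field `ℚ_p`. -/
def PadicModEq (p : ℕ) [Fact p.Prime] (n : ℕ) (x y : ℚ_[p]) : Prop :=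
  ∃ c : ℤ_[p], x - y = (p : ℚ_[p]) ^ n * (c : ℚ_[p])

/-! Put n = p^a, Δ = m(m-4). For k < n the signed coefficients (-1)^k C(hn-1, k) are affine in h
modulo p², so the sum is (1-h)·S₀ + h·S₁ with S₀, S₁ its values at h = 0 and h = 1. Both are
computed in ℤ[ω], ω² = (m-2)ω - 1, with conjugate ω̄ and Lucas sequences u_n = `im` ω^n, v_n = trace
ω^n.

S₁: comparing coefficients in (mX - (1+X)²)^(n-1) gives a sum of C(n-1,k)² ω^(n-1-k) ω̄^k. Since C²
≡ 2(-1)^k C - 1 modulo p², m^(n-1) S₁ ≡ 2Δ^((n-1)/2) - u_n.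

S₀: an exact identity with the coefficients C(2n,k) ≡ 2C(n,k) leads to powers of 1 + ω, a square
root of mω, and to (v_n + 2) m^(n-1) S₀ ≡ m^n u_n.

Frobenius lifted to p² reduces u_n, v_n to u_p, v_p. For δ = (Δ/p) = ±1, ω^(p-δ) ≡ 1 modulo p and
has norm 1, which expresses both through u_{p-δ}, a multiple of p. If δ = 0, then p ∣ m-4 and
Δ^((n-1)/2) vanishes modulo p² except when n = 3: this is ε. -/

/-! ### Binomial coefficients of h p^a - 1 modulo p² -/

theorem PadicInt.exists_pow_eq_mul {p : ℕ} [Fact p.Prime] {a j : ℕ} (hj : 0 < j) (hja : j < p ^ a) :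
    ∃ c : ℤ_[p], (p : ℤ_[p]) ^ a = j * (p * c) := by
  obtain ⟨b, r, hr, rfl⟩ := Nat.exists_eq_pow_mul_and_not_dvd hj.ne' p (Fact.out : p.Prime).ne_one
  have hb : b < a := by
    by_contra! hab
    have h1 := Nat.pow_le_pow_right (Fact.out : p.Prime).pos hab
    have hr0 : 0 < r := Nat.pos_of_ne_zero (by rintro rfl; simp at hr)
    nlinarith
  have hru : IsUnit (r : ℤ_[p]) := PadicInt.isUnit_iff.mpr <|
    PadicInt.norm_natCast_eq_one_iff.mpr ((Nat.Prime.coprime_iff_not_dvd Fact.out).mpr hr)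
  obtain ⟨u, hu⟩ := hru
  obtain ⟨d, rfl⟩ : ∃ d, a = b + 1 + d := ⟨a - (b + 1), by omega⟩
  refine ⟨(u⁻¹ : ℤ_[p]ˣ) * (p : ℤ_[p]) ^ d, ?_⟩
  push_cast
  rw [← hu, show (p : ℤ_[p]) ^ b * u * (p * ((u⁻¹ : ℤ_[p]ˣ) * (p : ℤ_[p]) ^ d))
    = (u * (u⁻¹ : ℤ_[p]ˣ)) * ((p : ℤ_[p]) ^ b * p * p ^ d) by ring, Units.mul_inv]
  ring

theorem Ring.succ_mul_choose_succ {R : Type*} [CommRing R] [BinomialRing R] (x : R) (k : ℕ) :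
    ((k : R) + 1) * Ring.choose x (k + 1) = (x - k) * Ring.choose x k := by
  have := Ring.choose_smul_choose x (Nat.le_succ k)
  simp only [Nat.succ_eq_add_one, add_tsub_cancel_left, Ring.choose_one_right,
    Nat.choose_succ_self_right, nsmul_eq_mul] at this
  push_cast at this
  rw [this, mul_comm]

/-- The ratio of consecutive terms is 1 - h p^a/(k+1). That `c` is independent of `h` is what makes
the dependence on `h` affine modulo p². -/
theorem PadicInt.exists_signed_choose_succ {p : ℕ} [Fact p.Prime] {a k : ℕ} (hk : k + 1 < p ^ a) :
    ∃ c : ℤ_[p], ∀ h : ℤ_[p], (-1) ^ (k + 1) * Ring.choose (h * (p : ℤ_[p]) ^ a - 1) (k + 1)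
      = (1 - h * (p * c)) * ((-1) ^ k * Ring.choose (h * (p : ℤ_[p]) ^ a - 1) k) := by
  obtain ⟨c, hc⟩ := PadicInt.exists_pow_eq_mul (p := p) (Nat.succ_pos k) hk
  refine ⟨c, fun h => ?_⟩
  have hk0 : ((k : ℤ_[p]) + 1) ≠ 0 := by exact_mod_cast Nat.succ_ne_zero k
  have := Ring.succ_mul_choose_succ (h * (p : ℤ_[p]) ^ a - 1) k
  apply mul_left_cancel₀ hk0
  push_cast at hc
  have e : h * (p : ℤ_[p]) ^ a - 1 - k = -((k + 1) * (1 - h * (p * c))) := by rw [hc]; ring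
  rw [e] at this
  linear_combination (-1) ^ (k + 1) * this

theorem PadicInt.prime_dvd_signed_choose_sub_one {p : ℕ} [Fact p.Prime] {a k : ℕ} (h : ℤ_[p])
    (hk : k < p ^ a) :
    (p : ℤ_[p]) ∣ (-1) ^ k * Ring.choose (h * (p : ℤ_[p]) ^ a - 1) k - 1 := by
  induction k with
  | zero => simp
  | succ k ih =>
    obtain ⟨c, hc⟩ := PadicInt.exists_signed_choose_succ hk
    obtain ⟨d, hd⟩ := ih (by omega)
    rw [hc h]
    exact ⟨d - h * c * ((-1) ^ k * Ring.choose (h * (p : ℤ_[p]) ^ a - 1) k),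
      by linear_combination hd⟩

/-- Modulo `p ^ 2` the numbers `(-1) ^ k * choose (h * p ^ a - 1) k` depend affinely on `h`. -/
theorem PadicInt.sq_dvd_signed_choose_sub {p : ℕ} [Fact p.Prime] {a k : ℕ} (h : ℤ_[p])
    (hk : k < p ^ a) :
    (p : ℤ_[p]) ^ 2 ∣ (-1) ^ k * Ring.choose (h * (p : ℤ_[p]) ^ a - 1) k
      - (1 + h * ((-1) ^ k * Ring.choose ((p : ℤ_[p]) ^ a - 1) k - 1)) := by
  induction k with
  | zero => simp
  | succ k ih =>
    obtain ⟨c, hc⟩ := PadicInt.exists_signed_choose_succ hk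
    obtain ⟨d, hd⟩ := ih (by omega)
    obtain ⟨e, he⟩ := PadicInt.prime_dvd_signed_choose_sub_one (a := a) (k := k) h (by omega)
    obtain ⟨e', he'⟩ := PadicInt.prime_dvd_signed_choose_sub_one (p := p) (a := a) (k := k) 1
      (by omega)
    have h1 := hc 1
    simp only [one_mul] at h1 he'
    rw [hc h, h1]
    -- Both signed coefficients are 1 modulo p, so exchanging them in a term with a factor p costs a
    -- multiple of p².
    exact ⟨d - h * c * (e - e'), by linear_combination hd - h * p * c * (he - he')⟩

theorem choose_pow_sub_one_signed (p : ℕ) [Fact p.Prime] (a b k : ℕ) (hb : 0 < b) :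
    Ring.choose ((b : ℤ_[p]) * (p : ℤ_[p]) ^ a - 1) k = (((b * p ^ a - 1).choose k : ℕ) : ℤ_[p]) := by
  rw [← Ring.choose_natCast]
  congr 1
  have : 1 ≤ b * p ^ a := Nat.mul_pos hb (pow_pos (Fact.out : p.Prime).pos _)
  push_cast [this]
  ring

theorem prime_dvd_signed_choose_sub_one {p a k : ℕ} (hp : p.Prime) (hk : k < p ^ a) :
    (p : ℤ) ∣ (-1) ^ k * ((p ^ a - 1).choose k : ℤ) - 1 := by
  have := Fact.mk hp
  have h := PadicInt.prime_dvd_signed_choose_sub_one (p := p) 1 hk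
  have e := choose_pow_sub_one_signed p a 1 k one_pos
  rw [Nat.cast_one, one_mul] at e
  rw [one_mul, e] at h
  have := (PadicInt.pow_p_dvd_int_iff (p := p) 1 ((-1) ^ k * ((p ^ a - 1).choose k : ℤ) - 1)).mp
    (by simpa using h)
  simpa using this

theorem sq_dvd_signed_choose_two_mul_sub {p a k : ℕ} (hp : p.Prime) (hk : k < p ^ a) :
    (p : ℤ) ^ 2 ∣ (-1) ^ k * ((2 * p ^ a - 1).choose k : ℤ)
      - (1 + 2 * ((-1) ^ k * ((p ^ a - 1).choose k : ℤ) - 1)) := by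
  have := Fact.mk hp
  have h := PadicInt.sq_dvd_signed_choose_sub (p := p) 2 hk
  have e := choose_pow_sub_one_signed p a 1 k one_pos
  have e2 := choose_pow_sub_one_signed p a 2 k two_pos
  rw [Nat.cast_one, one_mul] at e
  rw [Nat.cast_two] at e2
  rw [one_mul] at e
  rw [e, e2] at h
  exact_mod_cast (PadicInt.pow_p_dvd_int_iff (p := p) 2 _).mp (by exact_mod_cast h)

/-- Pascal's rule splits each coefficient into two neighbours of opposite sign, so the constants in
the affine formula at h = 2 cancel. It fails at k = 0, where 1 stands against 2. -/
theorem sq_dvd_choose_two_mul_sub {p a k : ℕ} (hp : p.Prime) (hk0 : 0 < k) (hk : k < p ^ a) :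
    (p : ℤ) ^ 2 ∣ ((2 * p ^ a).choose k : ℤ) - 2 * ((p ^ a).choose k : ℤ) := by
  obtain ⟨k, rfl⟩ := Nat.exists_eq_succ_of_ne_zero hk0.ne'
  obtain ⟨n, hn⟩ := Nat.exists_eq_succ_of_ne_zero (pow_pos hp.pos a).ne'
  obtain ⟨c, hc⟩ := sq_dvd_signed_choose_two_mul_sub hp hk
  obtain ⟨d, hd⟩ := sq_dvd_signed_choose_two_mul_sub (a := a) (k := k) hp (by omega)
  rw [hn] at hc hd ⊢
  simp only [Nat.succ_eq_add_one, add_tsub_cancel_right,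
    show 2 * (n + 1) = 2 * n + 1 + 1 by omega, Nat.choose_succ_succ (2 * n + 1) k,
    Nat.choose_succ_succ n k] at hc hd ⊢
  push_cast at hc hd ⊢
  have hs : ((-1 : ℤ) ^ k) * (-1) ^ k = 1 := by rw [← mul_pow]; simp
  refine ⟨(-1) ^ (k + 1) * (c - d), ?_⟩
  rw [pow_succ] at hc ⊢
  linear_combination -(-1) ^ k * (hc - hd) + (-((2 * n + 1).choose k : ℤ) - (2 * n + 1).choose (k + 1)
    + 2 * n.choose k + 2 * n.choose (k + 1)) * hs

/-- The square of (-1)^k C(p^a-1, k) - 1 is divisible by p². -/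
theorem sq_dvd_choose_sq_sub {p a k : ℕ} (hp : p.Prime) (hk : k < p ^ a) :
    (p : ℤ) ^ 2 ∣ ((p ^ a - 1).choose k : ℤ) ^ 2
      - (2 * ((-1) ^ k * ((p ^ a - 1).choose k : ℤ)) - 1) := by
  obtain ⟨c, hc⟩ := prime_dvd_signed_choose_sub_one hp hk
  have hs : ((-1 : ℤ) ^ k) * (-1) ^ k = 1 := by rw [← mul_pow]; simp
  refine ⟨c ^ 2, ?_⟩
  rw [← mul_pow, ← hc]
  linear_combination -((p ^ a - 1).choose k : ℤ) ^ 2 * hs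

/-! ### Exact identities for the two sums -/

section

open Finset

open Polynomial in
-- Both sides are the coefficient of X^M in (mX - (1+X)²)^M = ((α - X)(X - β))^M.
theorem sum_choose_mul_centralBinom_mul_pow {R : Type*} [CommRing R] (m α β : R) (hs : α + β = m - 2)
    (hp : α * β = 1) (M : ℕ) :
    ∑ k ∈ range (M + 1), (M.choose k : R) * ((2 * k).choose k : R) * (-1) ^ k * m ^ (M - k)
      = ∑ k ∈ range (M + 1), (M.choose k : R) ^ 2 * α ^ (M - k) * β ^ k := by
  have key : ((-1 : R[X]) * (1 + X) ^ 2 + C m * X) ^ M = (C α - X) ^ M * (X - C β) ^ M := by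
    rw [← mul_pow]
    congr 1
    have h1 : C α + C β = C m - 2 := by rw [← C_add, hs, C_sub]; rfl
    have h2 : C α * C β = 1 := by rw [← C_mul, hp, C_1]
    linear_combination -X * h1 + h2
  have := congrArg (fun q : R[X] => q.coeff M) key
  beta_reduce at this
  rw [add_pow, finsetSum_coeff] at this
  convert this using 1
  · refine sum_congr rfl fun k hk => ?_
    have hk : k ≤ M := by simpa [Nat.lt_succ_iff] using hk
    rw [show ((-1 : R[X]) * (1 + X) ^ 2) ^ k * (C m * X) ^ (M - k) * (M.choose k : R[X])
      = C ((-1) ^ k * m ^ (M - k) * (M.choose k : R)) * ((1 + X) ^ (2 * k) * X ^ (M - k)) by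
        simp only [map_mul, map_pow, map_neg, map_one, map_natCast, mul_pow, ← pow_mul]; ring,
      coeff_C_mul, coeff_mul_X_pow', if_pos (Nat.sub_le _ _), Nat.sub_sub_self hk,
      coeff_one_add_X_pow]
    ring
  · rw [coeff_mul, Nat.sum_antidiagonal_eq_sum_range_succ
      (fun i j => coeff ((C α - X) ^ M) i * coeff ((X - C β) ^ M) j)]
    refine sum_congr rfl fun k hk => ?_
    have hk : k ≤ M := by simpa [Nat.lt_succ_iff] using hk
    rw [show (C α - X : R[X]) = -(X + C (-α)) by rw [C_neg]; ring,
      show (X - C β : R[X]) = X + C (-β) by rw [C_neg]; ring, neg_pow, ← C_1, ← C_neg, ← C_pow, coeff_C_mul,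
      coeff_X_add_C_pow, coeff_X_add_C_pow, Nat.choose_symm hk, Nat.sub_sub_self hk, neg_pow α,
      neg_pow β, show ((-1 : R) ^ M) = (-1) ^ (M - k) * (-1) ^ k by rw [← pow_add]; congr 1; omega]
    have h1 : ((-1 : R) ^ k) * (-1) ^ k = 1 := by rw [← mul_pow]; simp
    have h2 : ((-1 : R) ^ (M - k)) * (-1) ^ (M - k) = 1 := by rw [← mul_pow]; simp
    linear_combination -(M.choose k : R) ^ 2 * α ^ (M - k) * β ^ k * (h1 * (-1 : R) ^ (M - k) * (-1) ^ (M - k) + h2)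

open QuadraticAlgebra

theorem lucasU_add_two (A B : ℤ) (n : ℕ) :
    lucasU A B (n + 2) = A * lucasU A B (n + 1) - B * lucasU A B n := rfl

theorem omega_pow_succ (A : ℤ) (n : ℕ) :
    (ω : QuadraticAlgebra ℤ (-1) A) ^ (n + 1) = ⟨-lucasU A 1 n, lucasU A 1 (n + 1)⟩ := by
  induction n with
  | zero => ext <;> simp [lucasU]
  | succ n ih =>
    rw [pow_succ, ih]
    ext
    · simp
    · simp [lucasU_add_two]
      ring

theorem im_omega_pow (A : ℤ) (n : ℕ) :
    ((ω : QuadraticAlgebra ℤ (-1) A) ^ n).im = lucasU A 1 n := by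
  cases n with
  | zero => simp [lucasU]
  | succ n => rw [omega_pow_succ]

theorem im_sum {ι R : Type*} [CommRing R] {a b : R} (s : Finset ι) (f : ι → QuadraticAlgebra R a b) :
    (∑ i ∈ s, f i).im = ∑ i ∈ s, (f i).im :=
  map_sum (imₗ (R := R) a b) f s

theorem im_one_add_omega_pow (A : ℤ) (n : ℕ) :
    ((1 + ω : QuadraticAlgebra ℤ (-1) A) ^ n).im
      = ∑ k ∈ range n, (n.choose k : ℤ) * lucasU A 1 (n - k) := by
  rw [add_pow, im_sum, sum_range_succ]
  simp only [one_pow, one_mul, im_mul, re_natCast, im_natCast, im_omega_pow, tsub_self]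
  simp [lucasU, mul_comm]

theorem sum_choose_succ_mul_succ (u : ℕ → ℤ) (M n : ℕ) :
    ∑ k ∈ range (n + 1), ((M + 1).choose k : ℤ) * u (n + 1 - k)
      = ∑ k ∈ range (n + 1), (M.choose k : ℤ) * u (n + 1 - k)
        + ∑ k ∈ range n, (M.choose k : ℤ) * u (n - k) := by
  rw [sum_range_succ', sum_range_succ' _ n]
  simp only [Nat.choose_succ_succ, Nat.add_sub_add_right, Nat.cast_add, add_mul, sum_add_distrib]
  simp
  ring

theorem sum_choose_mul_lucasU_add_two (A : ℤ) (M n : ℕ) :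
    ∑ k ∈ range (n + 2), (M.choose k : ℤ) * lucasU A 1 (n + 2 - k)
      = A * ∑ k ∈ range (n + 1), (M.choose k : ℤ) * lucasU A 1 (n + 1 - k)
        - ∑ k ∈ range n, (M.choose k : ℤ) * lucasU A 1 (n - k) + M.choose (n + 1) := by
  have h : ∑ k ∈ range n, (M.choose k : ℤ) * lucasU A 1 (n - k)
      = ∑ k ∈ range (n + 1), (M.choose k : ℤ) * lucasU A 1 (n - k) := by
    rw [sum_range_succ]; simp [lucasU]
  rw [h, sum_range_succ _ (n + 1), mul_sum, ← sum_sub_distrib]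
  congr 1
  · refine sum_congr rfl fun k hk => ?_
    have hk : k ≤ n := by simpa [Nat.lt_succ_iff] using hk
    rw [show n + 2 - k = (n - k) + 2 by omega, show n + 1 - k = (n - k) + 1 by omega,
      lucasU_add_two]
    ring
  · simp [show n + 2 - (n + 1) = 1 by omega, lucasU]

/-- Both sides satisfy S(n+1) = m S(n) + C(2n,n). On the right, m - 2 comes from the Lucas
recurrence and the remaining 2 from applying Pascal's rule twice. -/
theorem sum_centralBinom_mul_pow_eq (m : ℤ) (n : ℕ) :
    ∑ k ∈ range n, ((2 * k).choose k : ℤ) * m ^ (n - 1 - k)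
      = ∑ k ∈ range n, ((2 * n).choose k : ℤ) * lucasU (m - 2) 1 (n - k) := by
  induction n with
  | zero => simp
  | succ n ih =>
    have hl : ∑ k ∈ range (n + 1), ((2 * k).choose k : ℤ) * m ^ (n + 1 - 1 - k)
        = m * ∑ k ∈ range n, ((2 * k).choose k : ℤ) * m ^ (n - 1 - k) + (2 * n).choose n := by
      rw [sum_range_succ, mul_sum]
      congr 1
      · refine sum_congr rfl fun k hk => ?_
        have hk : k < n := by simpa using hk
        rw [show n + 1 - 1 - k = (n - 1 - k) + 1 by omega, pow_succ]
        ring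
      · simp
    rw [hl, ih, show 2 * (n + 1) = 2 * n + 1 + 1 by ring, sum_choose_succ_mul_succ,
      sum_choose_succ_mul_succ]
    cases n with
    | zero => simp [lucasU]
    | succ n =>
      rw [sum_choose_mul_lucasU_add_two, sum_choose_succ_mul_succ]
      ring

theorem star_omega_pow (A : ℤ) (n : ℕ) :
    (star ω : QuadraticAlgebra ℤ (-1) A) ^ n = ⟨lucasU A 1 (n + 1), -lucasU A 1 n⟩ := by
  rw [← star_pow]
  cases n with
  | zero => ext <;> simp [lucasU]
  | succ n =>
    rw [omega_pow_succ, star_mk, lucasU_add_two]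
    ext
    · simp
      ring
    · simp

theorem geom_sum_omega (A : ℤ) (n : ℕ) :
    ∑ k ∈ range n, (ω : QuadraticAlgebra ℤ (-1) A) ^ (n - 1 - k) * (star ω) ^ k
      = (lucasU A 1 n : QuadraticAlgebra ℤ (-1) A) := by
  induction n with
  | zero => simp [lucasU]
  | succ n ih =>
    have h : ∑ k ∈ range n, (ω : QuadraticAlgebra ℤ (-1) A) ^ (n + 1 - 1 - k) * (star ω) ^ k
        = ω * ∑ k ∈ range n, (ω : QuadraticAlgebra ℤ (-1) A) ^ (n - 1 - k) * (star ω) ^ k := by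
      rw [mul_sum]
      refine sum_congr rfl fun k hk => ?_
      have hk : k < n := by simpa using hk
      rw [show n + 1 - 1 - k = (n - 1 - k) + 1 by omega, pow_succ]
      ring
    rw [sum_range_succ, h, ih, star_omega_pow]
    ext
    · simp
    · simp

theorem omega_add_star (A : ℤ) : (ω + star ω : QuadraticAlgebra ℤ (-1) A) = (A : ℤ) := by
  ext
  · simp
  · simp

theorem omega_mul_star (A : ℤ) : (ω * star ω : QuadraticAlgebra ℤ (-1) A) = 1 := by
  ext
  · simp
  · simp

theorem omega_sub_star_sq (m : ℤ) :
    (ω - star ω : QuadraticAlgebra ℤ (-1) (m - 2)) ^ 2 = ((m * (m - 4) : ℤ) :) := by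
  rw [sq]
  ext
  · simp
    ring
  · simp
    ring

theorem dvd_re_im_of_intCast_dvd {a b d : ℤ} {x : QuadraticAlgebra ℤ a b}
    (h : (d : QuadraticAlgebra ℤ a b) ∣ x) : d ∣ x.re ∧ d ∣ x.im := by
  obtain ⟨c, rfl⟩ := h
  exact ⟨⟨c.re, by simp⟩, ⟨c.im, by simp⟩⟩

theorem dvd_trace_of_intCast_dvd {a b d : ℤ} {x : QuadraticAlgebra ℤ a b}
    (h : (d : QuadraticAlgebra ℤ a b) ∣ x) : d ∣ trace x := by
  obtain ⟨h1, h2⟩ := dvd_re_im_of_intCast_dvd h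
  rw [trace_def]
  exact dvd_add (h1.mul_left _) (h2.mul_left _)

/-! ### The two sums modulo p² -/

/-- Linearizing the squared binomials leaves 2(ω - ω̄)^(2N) = 2Δ^N and a geometric sum equal to u_n.
-/
theorem sq_dvd_sum_choose_sub {p a N : ℕ} (hp : p.Prime) (m : ℤ) (hN : p ^ a = 2 * N + 1) :
    (p : ℤ) ^ 2 ∣ ∑ k ∈ range (p ^ a), (-1) ^ k * ((p ^ a - 1).choose k : ℤ)
        * (((2 * k).choose k : ℤ) * m ^ (p ^ a - 1 - k))
      - (2 * (m * (m - 4)) ^ N - lucasU (m - 2) 1 (p ^ a)) := by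
  have key : (((p : ℤ) ^ 2 : ℤ) : QuadraticAlgebra ℤ (-1) (m - 2)) ∣
      ((∑ k ∈ range (p ^ a), (-1) ^ k * ((p ^ a - 1).choose k : ℤ)
        * (((2 * k).choose k : ℤ) * m ^ (p ^ a - 1 - k))
        - (2 * (m * (m - 4)) ^ N - lucasU (m - 2) 1 (p ^ a)) : ℤ) :) := by
    have h1 := sum_choose_mul_centralBinom_mul_pow (R := QuadraticAlgebra ℤ (-1) (m - 2)) m ω
      (star ω) (by rw [omega_add_star]; push_cast; ring) (omega_mul_star _) (2 * N)
    have h2 := geom_sum_omega (m - 2) (2 * N + 1)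
    have h3 : (-star ω + ω : QuadraticAlgebra ℤ (-1) (m - 2)) ^ (2 * N)
        = ((m * (m - 4) : ℤ) : QuadraticAlgebra ℤ (-1) (m - 2)) ^ N := by
      rw [neg_add_eq_sub, pow_mul, omega_sub_star_sq]
    rw [add_pow] at h3
    have h4 : ((∑ k ∈ range (p ^ a), (-1) ^ k * ((p ^ a - 1).choose k : ℤ)
        * (((2 * k).choose k : ℤ) * m ^ (p ^ a - 1 - k))
        - (2 * (m * (m - 4)) ^ N - lucasU (m - 2) 1 (p ^ a)) : ℤ) :
          QuadraticAlgebra ℤ (-1) (m - 2))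
        = ∑ k ∈ range (p ^ a), (((((p ^ a - 1).choose k : ℤ) ^ 2
          - (2 * ((-1) ^ k * ((p ^ a - 1).choose k : ℤ)) - 1) : ℤ)) :
          QuadraticAlgebra ℤ (-1) (m - 2)) * (ω ^ (p ^ a - 1 - k) * (star ω) ^ k) := by
      rw [hN]
      simp only [add_tsub_cancel_right] at h2 ⊢
      push_cast
      simp only [sub_mul, sum_sub_distrib, one_mul, h2]
      push_cast at h3 h1
      rw [← h3, mul_sum, sub_sub_eq_add_sub, sub_sub_eq_add_sub]
      congr 1
      · congr 1
        refine Eq.trans ?_ (h1.trans ?_)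
        · exact sum_congr rfl fun k _ => by ring
        · exact sum_congr rfl fun k _ => by ring
      · refine sum_congr rfl fun k _ => ?_
        rw [neg_pow]
        ring
    rw [h4]
    refine dvd_sum fun k hk => Dvd.dvd.mul_right ?_ _
    exact Int.cast_dvd_cast _ _ (sq_dvd_choose_sq_sub hp (by simpa using hk))
  simpa only [re_intCast, Int.cast_id] using (dvd_re_im_of_intCast_dvd key).1

/-- The term -u_n corrects k = 0, where the coefficient is 1 and not 2. -/
theorem sq_dvd_sum_centralBinom_sub {p a : ℕ} (hp : p.Prime) (m : ℤ) :
    (p : ℤ) ^ 2 ∣ ∑ k ∈ range (p ^ a), ((2 * k).choose k : ℤ) * m ^ (p ^ a - 1 - k)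
      - (2 * ((1 + ω : QuadraticAlgebra ℤ (-1) (m - 2)) ^ (p ^ a)).im
        - lucasU (m - 2) 1 (p ^ a)) := by
  rw [sum_centralBinom_mul_pow_eq, im_one_add_omega_pow]
  obtain ⟨n, hn⟩ := Nat.exists_eq_succ_of_ne_zero (pow_pos hp.pos a).ne'
  have h (k) (hk : k ∈ range n) := sq_dvd_choose_two_mul_sub (a := a) (k := k + 1) hp
    (Nat.succ_pos k) (by rw [hn]; simpa using hk)
  rw [hn] at h ⊢
  rw [sum_range_succ', sum_range_succ']
  have e := dvd_sum fun k hk => (h k hk).mul_right (lucasU (m - 2) 1 (n + 1 - (k + 1)))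
  simp only [sub_mul, sum_sub_distrib, mul_assoc, ← mul_sum] at e
  obtain ⟨c, hc⟩ := e
  refine ⟨c, hc ▸ ?_⟩
  simp
  ring

theorem Int.prime_dvd_pow_prime_pow_sub {p : ℕ} (hp : p.Prime) (x : ℤ) (a : ℕ) :
    (p : ℤ) ∣ x ^ p ^ a - x := by
  have := Fact.mk hp
  rw [← Int.modEq_iff_dvd, ← ZMod.intCast_eq_intCast_iff]
  push_cast
  rw [ZMod.pow_card_pow]

theorem dvd_trace_omega_pow_sub {p : ℕ} (a : ℕ) (hp : p.Prime) (A : ℤ) :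
    (p : ℤ) ∣ trace ((ω : QuadraticAlgebra ℤ (-1) A) ^ p ^ a) - A := by
  have h1 := Int.prime_dvd_pow_prime_pow_sub hp A a
  obtain ⟨r, hr⟩ := exists_add_pow_prime_pow_eq hp (ω : QuadraticAlgebra ℤ (-1) A) (star ω) a
  rw [mul_assoc _ _ (star ω), omega_mul_star, mul_one, omega_add_star, ← star_pow] at hr
  have h2 : (((p : ℤ) : ℤ) : QuadraticAlgebra ℤ (-1) A) ∣
      ((trace ((ω : QuadraticAlgebra ℤ (-1) A) ^ p ^ a) - A ^ p ^ a : ℤ) :) := by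
    refine ⟨-r, ?_⟩
    have := algebraMap_trace_eq_add_star ((ω : QuadraticAlgebra ℤ (-1) A) ^ p ^ a)
    rw [eq_intCast] at this
    push_cast
    rw [this, hr]
    ring
  have h3 := (dvd_re_im_of_intCast_dvd h2).1
  rw [re_intCast] at h3
  simpa using dvd_add h3 h1

theorem one_add_omega_sq (m : ℤ) :
    (1 + ω : QuadraticAlgebra ℤ (-1) (m - 2)) ^ 2 = (m : QuadraticAlgebra ℤ (-1) (m - 2)) * ω := by
  rw [sq]
  ext
  · simp
  · simp

theorem trace_mul_im_one_add_omega_pow (m : ℤ) (n : ℕ) :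
    trace ((1 + ω : QuadraticAlgebra ℤ (-1) (m - 2)) ^ n)
      * ((1 + ω : QuadraticAlgebra ℤ (-1) (m - 2)) ^ n).im = m ^ n * lucasU (m - 2) 1 n := by
  have h := sq_eq_trace_smul_sub_norm ((1 + ω : QuadraticAlgebra ℤ (-1) (m - 2)) ^ n)
  rw [← pow_mul, mul_comm n 2, pow_mul, one_add_omega_sq, mul_pow, ← Int.cast_pow,
    ← zsmul_eq_mul] at h
  have := congrArg QuadraticAlgebra.im h
  simp only [im_sub, im_smul, algebraMap_im, smul_eq_mul, sub_zero, im_omega_pow] at this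
  exact this.symm

theorem trace_one_add_omega_pow_sq (m : ℤ) (n : ℕ) :
    trace ((1 + ω : QuadraticAlgebra ℤ (-1) (m - 2)) ^ n) ^ 2
      = m ^ n * (trace ((ω : QuadraticAlgebra ℤ (-1) (m - 2)) ^ n) + 2) := by
  have h := sq_eq_trace_smul_sub_norm ((1 + ω : QuadraticAlgebra ℤ (-1) (m - 2)) ^ n)
  have hn : norm (1 + ω : QuadraticAlgebra ℤ (-1) (m - 2)) = m := by
    simp [norm_def]
    ring
  rw [← pow_mul, mul_comm n 2, pow_mul, one_add_omega_sq, mul_pow, ← Int.cast_pow, map_pow QuadraticAlgebra.norm, hn] at h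
  have h' := congrArg trace h
  rw [← zsmul_eq_mul, map_sub, map_zsmul, map_smul, trace_algebraMap] at h'
  simp only [smul_eq_mul] at h'
  linear_combination -h'

theorem dvd_trace_one_add_omega_pow_sub {p : ℕ} (a : ℕ) (hp : p.Prime) (m : ℤ) :
    (p : ℤ) ∣ trace ((1 + ω : QuadraticAlgebra ℤ (-1) (m - 2)) ^ p ^ a) - m := by
  obtain ⟨r, hr⟩ := exists_add_pow_prime_pow_eq hp (1 : QuadraticAlgebra ℤ (-1) (m - 2)) ω a
  have h : (((p : ℤ) : ℤ) : QuadraticAlgebra ℤ (-1) (m - 2)) ∣ (1 + ω) ^ p ^ a - 1 - ω ^ p ^ a :=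
    ⟨ω * r, by rw [hr]; push_cast; ring⟩
  have h1 := dvd_trace_of_intCast_dvd h
  rw [map_sub, map_sub, trace_one] at h1
  obtain ⟨x, hx⟩ := h1
  obtain ⟨y, hy⟩ := dvd_trace_omega_pow_sub a hp (m - 2)
  exact ⟨x + y, by linear_combination hx + hy⟩

/-- `(v_n + 2) * ∑ k < n, choose (2 * k) k * m ^ (n - 1 - k) ≡ m ^ n * u_n` for `n = p ^ a`. -/
theorem sq_dvd_mul_sum_centralBinom_sub {p a : ℕ} (hp : p.Prime) {m : ℤ} (hm : ¬ (p : ℤ) ∣ m) :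
    (p : ℤ) ^ 2 ∣ (trace ((ω : QuadraticAlgebra ℤ (-1) (m - 2)) ^ p ^ a) + 2)
        * ∑ k ∈ range (p ^ a), ((2 * k).choose k : ℤ) * m ^ (p ^ a - 1 - k)
      - m ^ p ^ a * lucasU (m - 2) 1 (p ^ a) := by
  have h1 := Int.prime_dvd_pow_prime_pow_sub hp m a
  have h2 := dvd_trace_one_add_omega_pow_sub a hp m
  have h3 := trace_mul_im_one_add_omega_pow m (p ^ a)
  have h4 := trace_one_add_omega_pow_sq m (p ^ a)
  obtain ⟨c, hc⟩ := sq_dvd_sum_centralBinom_sub (a := a) hp m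
  obtain ⟨d, hd⟩ := dvd_sub h2 h1
  rw [sub_sub_sub_cancel_right] at hd
  have hcop : IsCoprime ((p : ℤ) ^ 2) (m ^ p ^ a) :=
    (((Nat.prime_iff_prime_int.mp hp).coprime_iff_not_dvd).mpr hm).pow
  refine hcop.dvd_of_dvd_mul_left ⟨c * m ^ p ^ a *
    (trace ((ω : QuadraticAlgebra ℤ (-1) (m - 2)) ^ p ^ a) + 2)
    - lucasU (m - 2) 1 (p ^ a) * d ^ 2, ?_⟩
  generalize trace ((1 + ω : QuadraticAlgebra ℤ (-1) (m - 2)) ^ p ^ a) = t at *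
  generalize ((1 + ω : QuadraticAlgebra ℤ (-1) (m - 2)) ^ p ^ a).im = w at *
  generalize trace ((ω : QuadraticAlgebra ℤ (-1) (m - 2)) ^ p ^ a) = v at *
  generalize lucasU (m - 2) 1 (p ^ a) = u at *
  generalize m ^ p ^ a = M at *
  -- Since t ≡ M modulo p, (t - M)² ≡ 0. With M(v+2) = t² and tw = Mu this gives M(v+2)(2w - u) =
  -- u(2tM - t²) ≡ uM².
  linear_combination M * (v + 2) * hc - (2 * w - u) * h4 + 2 * t * h3
    - u * (t - M + p * d) * hd

/-! ### Frobenius on ω and the reduction from p^a to p -/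

/-- Write 2ω = (m-2) + (ω - ω̄). Modulo p, the p-th power fixes integers and multiplies ω - ω̄ by
Δ^N ≡ δ. -/
theorem dvd_two_mul_omega_pow_sub {p N : ℕ} (hp : p.Prime) (hN : p = 2 * N + 1) {m δ : ℤ}
    (hδ : (p : ℤ) ∣ (m * (m - 4)) ^ N - δ) (b : ℕ) :
    (p : QuadraticAlgebra ℤ (-1) (m - 2)) ∣ (2 * ω) ^ p ^ b
      - (((m - 2 : ℤ) : QuadraticAlgebra ℤ (-1) (m - 2)) + ((δ ^ b : ℤ) : QuadraticAlgebra ℤ (-1) (m - 2)) * (ω - star ω)) := by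
  induction b with
  | zero =>
    refine ⟨0, ?_⟩
    rw [← omega_add_star]
    push_cast
    ring
  | succ b ih =>
    obtain ⟨z, hz⟩ := dvd_sub_pow_of_dvd_sub ih 1
    rw [← pow_mul, pow_one] at hz
    obtain ⟨x, hx⟩ := Int.prime_dvd_pow_prime_pow_sub hp (m - 2) 1
    obtain ⟨y, hy⟩ := Int.prime_dvd_pow_prime_pow_sub hp (δ ^ b) 1
    obtain ⟨w, hw⟩ := hδ
    rw [pow_one] at hx hy
    obtain ⟨r, hr⟩ := exists_add_pow_prime_eq hp
      ((m - 2 : ℤ) : QuadraticAlgebra ℤ (-1) (m - 2)) (((δ ^ b : ℤ) : QuadraticAlgebra ℤ (-1) (m - 2)) * (ω - star ω))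
    have hD : (ω - star ω : QuadraticAlgebra ℤ (-1) (m - 2)) ^ p
        = (ω - star ω) * (((m * (m - 4)) ^ N : ℤ) : QuadraticAlgebra ℤ (-1) (m - 2)) := by
      conv_lhs => rw [hN, pow_succ', pow_mul, omega_sub_star_sq]
      push_cast
      ring
    rw [mul_pow _ _ p, hD] at hr
    replace hx := congrArg (fun t : ℤ => (t : QuadraticAlgebra ℤ (-1) (m - 2))) hx
    replace hy := congrArg (fun t : ℤ => (t : QuadraticAlgebra ℤ (-1) (m - 2))) hy
    replace hw := congrArg (fun t : ℤ => (t : QuadraticAlgebra ℤ (-1) (m - 2))) hw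
    rw [← pow_succ] at hz
    rw [pow_succ δ]
    push_cast at hz hx hy hw hr ⊢
    generalize (ω - star ω : QuadraticAlgebra ℤ (-1) (m - 2)) = D at *
    generalize ((δ : QuadraticAlgebra ℤ (-1) (m - 2)) ^ b) = e at *
    refine ⟨p * z + x + y * D * (δ + p * w) + e * D * w + (m - 2) * (e * D) * r, ?_⟩
    linear_combination hz + hr + hx + D * ((m : QuadraticAlgebra ℤ (-1) (m - 2)) * (m - 4)) ^ N * hy
      + D * (e + p * y) * hw

/-- Taking p-th powers lifts a congruence modulo p to one modulo p². -/
theorem sq_dvd_two_mul_omega_pow_sub {p N : ℕ} (hp : p.Prime) (hN : p = 2 * N + 1) {m δ : ℤ}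
    (hδ : (p : ℤ) ∣ (m * (m - 4)) ^ N - δ) (b : ℕ) :
    (((p : ℤ) ^ 2 : ℤ) : QuadraticAlgebra ℤ (-1) (m - 2)) ∣ ((2 ^ p : ℤ) : QuadraticAlgebra ℤ (-1) (m - 2)) * ω ^ p ^ (b + 1)
      - (((m - 2 : ℤ) : QuadraticAlgebra ℤ (-1) (m - 2)) + ((δ ^ b : ℤ) : QuadraticAlgebra ℤ (-1) (m - 2)) * (ω - star ω)) ^ p := by
  obtain ⟨z, hz⟩ := dvd_sub_pow_of_dvd_sub (dvd_two_mul_omega_pow_sub hp hN hδ b) 1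
  obtain ⟨w, hw⟩ := dvd_sub_pow_of_dvd_sub (p := p) (Int.prime_dvd_pow_prime_pow_sub hp 2 b) 1
  rw [← pow_mul, pow_one, ← pow_succ, mul_pow] at hz
  rw [← pow_mul, pow_one, ← pow_succ] at hw
  replace hw := congrArg (fun t : ℤ => (t : QuadraticAlgebra ℤ (-1) (m - 2))) hw
  push_cast at hz hw ⊢
  exact ⟨z - (w : QuadraticAlgebra ℤ (-1) (m - 2)) * ω ^ p ^ (b + 1), by linear_combination hz - ω ^ p ^ (b + 1) * hw⟩

theorem isCoprime_sq_two_pow {p : ℕ} (hodd : Odd p) (n : ℕ) :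
    IsCoprime ((p : ℤ) ^ 2) (2 ^ n) := by
  refine IsCoprime.pow ?_
  exact_mod_cast (Nat.isCoprime_iff_coprime (m := p) (n := 2)).mpr hodd.coprime_two_right

/-- For δ^b = ±1 the base (m-2) + δ^b(ω - ω̄) is 2ω or 2ω̄; conjugation negates `im` and keeps the
trace. -/
theorem lucasU_prime_pow_modEq {p N : ℕ} (hp : p.Prime) (hN : p = 2 * N + 1) {m δ : ℤ}
    (hδ : (p : ℤ) ∣ (m * (m - 4)) ^ N - δ) (h1 : δ = 1 ∨ δ = -1) (b : ℕ) :
    (p : ℤ) ^ 2 ∣ lucasU (m - 2) 1 (p ^ (b + 1)) - δ ^ b * lucasU (m - 2) 1 p ∧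
    (p : ℤ) ^ 2 ∣ trace ((ω : QuadraticAlgebra ℤ (-1) (m - 2)) ^ p ^ (b + 1))
      - trace ((ω : QuadraticAlgebra ℤ (-1) (m - 2)) ^ p) := by
  have hodd : Odd p := ⟨N, hN⟩
  have h := sq_dvd_two_mul_omega_pow_sub hp hN hδ b
  have hb : δ ^ b = 1 ∨ δ ^ b = -1 := by
    rcases h1 with rfl | rfl
    · simp
    · exact neg_one_pow_eq_or ℤ b
  rw [← omega_add_star] at h
  have hc := isCoprime_sq_two_pow hodd p
  rcases hb with hb | hb
  · rw [hb, Int.cast_one, one_mul, show ω + star ω + (ω - star ω) =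
      ((2 : ℤ) : QuadraticAlgebra ℤ (-1) (m - 2)) * ω by push_cast; ring, mul_pow,
      ← Int.cast_pow (2 : ℤ) p, ← mul_sub, ← zsmul_eq_mul] at h
    have h2 := (dvd_re_im_of_intCast_dvd h).2
    have h3 := dvd_trace_of_intCast_dvd h
    simp only [im_smul, im_sub, im_omega_pow, map_smul, map_sub, smul_eq_mul] at h2 h3
    rw [hb, one_mul]
    exact ⟨hc.dvd_of_dvd_mul_left h2, hc.dvd_of_dvd_mul_left h3⟩
  · rw [hb, Int.cast_neg, Int.cast_one, neg_one_mul, show ω + star ω + -(ω - star ω) =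
      ((2 : ℤ) : QuadraticAlgebra ℤ (-1) (m - 2)) * star ω by push_cast; ring, mul_pow,
      ← Int.cast_pow (2 : ℤ) p, ← mul_sub, ← zsmul_eq_mul] at h
    have h2 := (dvd_re_im_of_intCast_dvd h).2
    have h3 := dvd_trace_of_intCast_dvd h
    simp only [im_smul, im_sub, im_omega_pow, star_omega_pow, smul_eq_mul] at h2
    simp only [← star_pow, map_smul, map_sub, trace_star, smul_eq_mul] at h3
    rw [hb, neg_one_mul]
    exact ⟨hc.dvd_of_dvd_mul_left h2, hc.dvd_of_dvd_mul_left h3⟩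

theorem sq_dvd_lucasU_prime_pow {p N : ℕ} (hp : p.Prime) (hN : p = 2 * N + 1) {m : ℤ}
    (h : (p : ℤ) ∣ (m * (m - 4)) ^ N) {b : ℕ} (hb : b ≠ 0) :
    (p : ℤ) ^ 2 ∣ lucasU (m - 2) 1 (p ^ (b + 1)) := by
  have h := sq_dvd_two_mul_omega_pow_sub hp hN (δ := 0) (by simpa using h) b
  rw [zero_pow hb, Int.cast_zero, zero_mul, add_zero, ← Int.cast_pow, ← zsmul_eq_mul] at h
  have h2 := (dvd_re_im_of_intCast_dvd h).2
  simp only [im_smul, im_sub, im_omega_pow, smul_eq_mul, im_intCast, sub_zero] at h2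
  exact (isCoprime_sq_two_pow ⟨N, hN⟩ p).dvd_of_dvd_mul_left h2

theorem dvd_lucasU_prime {p N : ℕ} (hp : p.Prime) (hN : p = 2 * N + 1) {m : ℤ}
    (h : (p : ℤ) ∣ (m * (m - 4)) ^ N) :
    (p : ℤ) ∣ lucasU (m - 2) 1 p := by
  have h := dvd_two_mul_omega_pow_sub hp hN (δ := 0) (by simpa using h) 1
  rw [show (2 * ω : QuadraticAlgebra ℤ (-1) (m - 2)) = ((2 : ℤ) : QuadraticAlgebra ℤ (-1) (m - 2)) * ω by push_cast; rfl, mul_pow,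
    pow_one, pow_one, Int.cast_zero, zero_mul, add_zero, ← Int.cast_pow, ← zsmul_eq_mul,
    ← Int.cast_natCast p] at h
  have h2 := (dvd_re_im_of_intCast_dvd h).2
  simp only [im_smul, im_sub, im_omega_pow, smul_eq_mul, im_intCast, sub_zero] at h2
  exact ((isCoprime_sq_two_pow ⟨N, hN⟩ p).of_isCoprime_of_dvd_left
    (dvd_pow_self _ two_ne_zero)).dvd_of_dvd_mul_left h2

/-- Norm 1 means (trace - 2)(trace + 2) = Δ·im², and trace + 2 ≡ 4 is prime to p. -/
theorem sq_dvd_trace_sub_two {p : ℕ} (hp : p.Prime) (hodd : Odd p) {m : ℤ}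
    {x : QuadraticAlgebra ℤ (-1) (m - 2)} (hx : QuadraticAlgebra.norm x = 1) (h1 : (p : ℤ) ∣ x.im)
    (h2 : (p : ℤ) ∣ trace x - 2) : (p : ℤ) ^ 2 ∣ trace x - 2 := by
  obtain ⟨c, hc⟩ := h1
  obtain ⟨d, hd⟩ := h2
  have h4 : IsCoprime ((p : ℤ) ^ 2) (trace x + 2) := by
    refine IsCoprime.pow_left (((Nat.prime_iff_prime_int.mp hp).coprime_iff_not_dvd).mpr ?_)
    intro h
    have h5 := dvd_sub h ⟨d, hd⟩
    rw [show trace x + 2 - (trace x - 2) = 2 ^ 2 by ring] at h5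
    have h6 := (isCoprime_sq_two_pow hodd 2).of_isCoprime_of_dvd_left (dvd_pow_self _ two_ne_zero)
    exact (Nat.prime_iff_prime_int.mp hp).not_isUnit (h6.isUnit_of_dvd' dvd_rfl h5)
  refine h4.dvd_of_dvd_mul_left ⟨m * (m - 4) * c ^ 2, ?_⟩
  rw [norm_def] at hx
  rw [trace_def]
  linear_combination 4 * hx + m * (m - 4) * (x.im + p * c) * hc

theorem dvd_two_mul_omega_pow_prime_sub {p N : ℕ} (hp : p.Prime) (hN : p = 2 * N + 1) {m δ : ℤ}
    (hδ : (p : ℤ) ∣ (m * (m - 4)) ^ N - δ) :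
    ((p : ℤ) : QuadraticAlgebra ℤ (-1) (m - 2)) ∣ 2 * ω ^ p
      - (ω + star ω + (δ : QuadraticAlgebra ℤ (-1) (m - 2)) * (ω - star ω)) := by
  obtain ⟨z, hz⟩ := dvd_two_mul_omega_pow_sub hp hN hδ 1
  obtain ⟨w, hw⟩ := Int.prime_dvd_pow_prime_pow_sub hp 2 1
  replace hw := congrArg (fun t : ℤ => (t : QuadraticAlgebra ℤ (-1) (m - 2))) hw
  rw [mul_pow, pow_one, pow_one] at hz
  rw [pow_one] at hw
  rw [omega_add_star]
  push_cast at hz hw ⊢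
  exact ⟨z - (w : QuadraticAlgebra ℤ (-1) (m - 2)) * ω ^ p, by linear_combination hz - ω ^ p * hw⟩

/-- The relations between `u_p`, `v_p` and `u_{p - δ}` modulo `p ^ 2`. -/
theorem lucasU_prime_modEq {p N : ℕ} (hp : p.Prime) (hN : p = 2 * N + 1) {m δ : ℤ}
    (hδ : (p : ℤ) ∣ (m * (m - 4)) ^ N - δ) (h1 : δ = 1 ∨ δ = -1) :
    (p : ℤ) ∣ lucasU (m - 2) 1 ((p : ℤ) - δ).toNat ∧
    (p : ℤ) ^ 2 ∣ 2 * lucasU (m - 2) 1 p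
      - (2 * δ + (m - 2) * lucasU (m - 2) 1 ((p : ℤ) - δ).toNat) ∧
    (p : ℤ) ^ 2 ∣ 2 * trace ((ω : QuadraticAlgebra ℤ (-1) (m - 2)) ^ p)
      - (2 * (m - 2) + δ * (m * (m - 4)) * lucasU (m - 2) 1 ((p : ℤ) - δ).toNat) := by
  have hodd : Odd p := ⟨N, hN⟩
  have h2 : IsCoprime (p : ℤ) (2 ^ 1) :=
    (isCoprime_sq_two_pow hodd 1).of_isCoprime_of_dvd_left (dvd_pow_self _ two_ne_zero)
  rw [pow_one] at h2
  have hnorm (n : ℕ) : QuadraticAlgebra.norm ((ω : QuadraticAlgebra ℤ (-1) (m - 2)) ^ n) = 1 := by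
    rw [map_pow]
    simp [norm_def]
  have h := dvd_two_mul_omega_pow_prime_sub hp hN hδ
  -- Used for x = ω^(p-δ): modulo p, ω^p is ω or ω̄ as δ = 1 or -1, so x ≡ 1.
  have key (x : QuadraticAlgebra ℤ (-1) (m - 2)) (hx : QuadraticAlgebra.norm x = 1)
      (hdvd : ((p : ℤ) : QuadraticAlgebra ℤ (-1) (m - 2)) ∣ (2 : ℤ) • (x - 1)) :
      (p : ℤ) ∣ x.im ∧ (p : ℤ) ^ 2 ∣ trace x - 2 := by
    have e1 := (dvd_re_im_of_intCast_dvd hdvd).2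
    have e2 := dvd_trace_of_intCast_dvd hdvd
    rw [im_smul, smul_eq_mul] at e1
    rw [map_smul, smul_eq_mul, map_sub, trace_one] at e2
    replace e1 := h2.dvd_of_dvd_mul_left e1
    replace e2 := h2.dvd_of_dvd_mul_left e2
    simp only [im_sub, QuadraticAlgebra.im_one, sub_zero] at e1
    exact ⟨e1, sq_dvd_trace_sub_two hp hodd hx e1 e2⟩
  rcases h1 with rfl | rfl
  · have hq : ((p : ℤ) - 1).toNat = 2 * N := by omega
    have hpow : (ω : QuadraticAlgebra ℤ (-1) (m - 2)) ^ p = ω ^ (2 * N) * ω := by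
      rw [← pow_succ, hN]
    obtain ⟨k1, k2⟩ := key (ω ^ (2 * N)) (hnorm _) <| by
      refine (h.mul_right (star ω)).trans (dvd_of_eq ?_)
      rw [hpow, zsmul_eq_mul]
      push_cast
      linear_combination (2 * ω ^ (2 * N) - 2) * omega_mul_star (m - 2)
    rw [hq, ← im_omega_pow, ← im_omega_pow, hpow]
    refine ⟨k1, ?_, ?_⟩
    · refine k2.trans (dvd_of_eq ?_)
      simp only [trace_def, im_mul, omega_re, omega_im]
      ring
    · refine (k2.mul_left (m - 2)).trans (dvd_of_eq ?_)
      simp only [trace_def, im_mul, re_mul, omega_re, omega_im]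
      ring
  · have hq : ((p : ℤ) - (-1)).toNat = p + 1 := by omega
    have hpow : (ω : QuadraticAlgebra ℤ (-1) (m - 2)) ^ p = ω ^ (p + 1) * star ω := by
      rw [pow_succ, mul_assoc, omega_mul_star, mul_one]
    obtain ⟨k1, k2⟩ := key (ω ^ (p + 1)) (hnorm _) <| by
      refine (h.mul_right ω).trans (dvd_of_eq ?_)
      rw [zsmul_eq_mul]
      push_cast
      linear_combination (- 2) * omega_mul_star (m - 2)
    rw [hq, ← im_omega_pow, ← im_omega_pow, hpow]
    refine ⟨k1, ?_, ?_⟩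
    · refine (k2.mul_left (-1)).trans (dvd_of_eq ?_)
      simp only [trace_def, im_mul, re_star, im_star, omega_re, omega_im]
      ring
    · refine (k2.mul_left (m - 2)).trans (dvd_of_eq ?_)
      simp only [trace_def, im_mul, re_mul, re_star, im_star, omega_re, omega_im]
      ring

/-! ### The cases h = 0 and h = 1 -/

/-- The exponents (p^(b+1) - 1)/2 obey n ↦ np + N; a p-th power lifts x^n ≡ δ^(b+1) to p², and δ^p =
δ. -/
theorem sq_dvd_pow_half_sub {p N : ℕ} (hN : p = 2 * N + 1) {x δ : ℤ}
    (h : (p : ℤ) ∣ x ^ N - δ) (h1 : δ = 0 ∨ δ = 1 ∨ δ = -1) (b : ℕ) :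
    ∃ n, p ^ (b + 1) = 2 * n + 1 ∧ (p : ℤ) ^ 2 ∣ x ^ n - δ ^ b * x ^ N := by
  have hδ : δ ^ p = δ := by
    rcases h1 with rfl | rfl | rfl
    · exact zero_pow (by omega)
    · simp
    · exact Odd.neg_one_pow ⟨N, hN⟩
  induction b with
  | zero => exact ⟨N, by simpa using hN, by simp⟩
  | succ b ih =>
    obtain ⟨n, hn, c, hc⟩ := ih
    obtain ⟨d, hd⟩ := h
    have h2 : (p : ℤ) ∣ x ^ n - δ ^ (b + 1) :=
      ⟨p * c + δ ^ b * d, by rw [pow_succ]; linear_combination hc + δ ^ b * hd⟩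
    obtain ⟨e, he⟩ := dvd_sub_pow_of_dvd_sub h2 1
    refine ⟨n * p + N, ?_, e * x ^ N, ?_⟩
    · rw [pow_succ, hn, add_mul, one_mul]
      nth_rw 2 [hN]
      ring
    · rw [pow_one, ← pow_mul, ← pow_mul, mul_comm (b + 1) p, pow_mul δ, hδ] at he
      rw [pow_add]
      linear_combination x ^ N * he

theorem prime_dvd_sub_four {p N : ℕ} (hp : p.Prime) {m : ℤ} (hm : ¬ (p : ℤ) ∣ m)
    (h : (p : ℤ) ∣ (m * (m - 4)) ^ N) : (p : ℤ) ∣ m - 4 :=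
  have hp' := Nat.prime_iff_prime_int.mp hp
  (hp'.dvd_or_dvd (hp'.dvd_of_dvd_pow h)).resolve_left hm

/-- The congruence (v_n + 2)Z ≡ m^n u_n is solved for Z, as v_n + 2 ≡ m is invertible modulo p. For
δ = ±1, the square of u_{p-δ} drops out. -/
theorem sq_dvd_sum_centralBinom_mul_pow_sub {p N : ℕ} (hp : p.Prime) (hN : p = 2 * N + 1)
    {m δ : ℤ} (hm : ¬ (p : ℤ) ∣ m) (hδ : (p : ℤ) ∣ (m * (m - 4)) ^ N - δ)
    (h1 : δ = 0 ∨ δ = 1 ∨ δ = -1) (b : ℕ) :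
    (p : ℤ) ^ 2 ∣ ∑ k ∈ range (p ^ (b + 1)), ((2 * k).choose k : ℤ) * m ^ (p ^ (b + 1) - 1 - k)
      - m ^ (p ^ (b + 1) - 1) * (δ ^ b * lucasU (m - 2) 1 ((p : ℤ) - δ).toNat + δ ^ (b + 1)) := by
  have hp' := Nat.prime_iff_prime_int.mp hp
  have hodd : Odd p := ⟨N, hN⟩
  have h0 := sq_dvd_mul_sum_centralBinom_sub (a := b + 1) hp hm
  have hv := dvd_trace_omega_pow_sub (b + 1) hp (m - 2)
  rw [show m ^ p ^ (b + 1) = m ^ (p ^ (b + 1) - 1) * m by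
    rw [← pow_succ, Nat.sub_add_cancel (Nat.pos_of_ne_zero (pow_pos hp.pos _).ne')]] at h0
  generalize ∑ k ∈ range (p ^ (b + 1)), ((2 * k).choose k : ℤ) * m ^ (p ^ (b + 1) - 1 - k) = Z at *
  generalize m ^ (p ^ (b + 1) - 1) = M at *
  obtain ⟨c, hc⟩ := h0
  by_cases hz : δ = 0
  · subst hz
    rw [sub_zero] at hδ
    obtain ⟨d, hd⟩ := hv
    have hcop : IsCoprime ((p : ℤ) ^ 2)
        (trace ((ω : QuadraticAlgebra ℤ (-1) (m - 2)) ^ p ^ (b + 1)) + 2) := by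
      refine IsCoprime.pow_left (hp'.coprime_iff_not_dvd.mpr fun h => hm ?_)
      have := dvd_sub h ⟨d, hd⟩
      rwa [show ∀ t : ℤ, t + 2 - (t - (m - 2)) = m by intro t; ring] at this
    refine hcop.dvd_of_dvd_mul_left ?_
    cases b with
    | zero =>
      obtain ⟨x, hx⟩ := dvd_lucasU_prime hp hN hδ
      simp only [zero_add, pow_one, pow_zero, one_mul, sub_zero, Int.toNat_natCast, add_zero] at *
      refine ⟨c - d * M * x, ?_⟩
      linear_combination hc - M * lucasU (m - 2) 1 p * hd - M * p * d * hx
    | succ b =>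
      obtain ⟨x, hx⟩ := sq_dvd_lucasU_prime_pow hp hN hδ b.succ_ne_zero
      rw [zero_pow (Nat.succ_ne_zero _), zero_pow (Nat.succ_ne_zero _)]
      exact ⟨c + M * m * x, by linear_combination hc + M * m * hx⟩
  · have h1 := h1.resolve_left hz
    have hsq : δ ^ 2 = 1 := by rcases h1 with rfl | rfl <;> norm_num
    obtain ⟨⟨x1, hx1⟩, ⟨x2, hx2⟩⟩ := lucasU_prime_pow_modEq hp hN hδ h1 b
    obtain ⟨⟨y1, hy1⟩, ⟨y2, hy2⟩, ⟨y3, hy3⟩⟩ := lucasU_prime_modEq hp hN hδ h1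
    have hcop : IsCoprime ((p : ℤ) ^ 2)
        (2 * m + δ * (m * (m - 4)) * lucasU (m - 2) 1 ((p : ℤ) - δ).toNat) := by
      refine IsCoprime.pow_left (hp'.coprime_iff_not_dvd.mpr fun h => hm ?_)
      have h2 : (p : ℤ) ∣ 2 * m := by
        have := dvd_sub h (Dvd.intro _ hy1.symm |>.mul_left (δ * (m * (m - 4))))
        rwa [add_sub_cancel_right] at this
      exact ((isCoprime_sq_two_pow hodd 1).of_isCoprime_of_dvd_left
        (dvd_pow_self _ two_ne_zero)).dvd_of_dvd_mul_left (by simpa using h2)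
    refine hcop.dvd_of_dvd_mul_left ?_
    rw [pow_succ δ]
    generalize lucasU (m - 2) 1 ((p : ℤ) - δ).toNat = X at *
    generalize trace ((ω : QuadraticAlgebra ℤ (-1) (m - 2)) ^ p ^ (b + 1)) = vn at *
    generalize trace ((ω : QuadraticAlgebra ℤ (-1) (m - 2)) ^ p) = v at *
    generalize lucasU (m - 2) 1 (p ^ (b + 1)) = un at *
    generalize lucasU (m - 2) 1 p = u at *
    generalize δ ^ b = e at *
    refine ⟨2 * c - Z * (2 * x2 + y3) + M * m * (2 * x1 + e * y2)
      - M * e * δ * (m * (m - 4)) * y1 ^ 2, ?_⟩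
    linear_combination 2 * hc - Z * (2 * hx2 + hy3) + M * m * (2 * hx1 + e * hy2)
      - M * e * δ * (m * (m - 4)) * (X + p * y1) * hy1 - M * e * m * (m - 4) * X * hsq

/-- Expanding (x^N - δ)² ≡ 0 trades the half power Δ^N for Δ^(p-1), which factors into powers of m
and m - 4. -/
theorem two_mul_pow_half_sub {p N : ℕ} {x δ : ℤ} (h : (p : ℤ) ∣ x ^ N - δ) (hsq : δ ^ 2 = 1) :
    (p : ℤ) ^ 2 ∣ 2 * x ^ N - δ * (1 + x ^ (2 * N)) := by
  obtain ⟨c, hc⟩ := h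
  refine ⟨-δ * c ^ 2, ?_⟩
  rw [mul_comm 2 N, pow_mul]
  linear_combination -δ * (x ^ N - δ + p * c) * hc - (2 * x ^ N - δ) * hsq

theorem sq_dvd_two_mul_sum_choose_sub {p N : ℕ} (hp : p.Prime) (hN : p = 2 * N + 1)
    {m δ : ℤ} (hm : ¬ (p : ℤ) ∣ m) (hδ : (p : ℤ) ∣ (m * (m - 4)) ^ N - δ)
    (h1 : δ = 0 ∨ δ = 1 ∨ δ = -1) (b : ℕ) :
    (p : ℤ) ^ 2 ∣ 2 * ∑ k ∈ range (p ^ (b + 1)), (-1) ^ k * ((p ^ (b + 1) - 1).choose k : ℤ)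
        * (((2 * k).choose k : ℤ) * m ^ (p ^ (b + 1) - 1 - k))
      - m ^ (p ^ (b + 1) - 1) * (δ ^ b * (2 - m) * lucasU (m - 2) 1 ((p : ℤ) - δ).toNat
        + 2 * δ ^ (b + 1) * (m - 4) ^ (p - 1)
        - 2 * if p ^ (b + 1) = 3 ∧ 3 ∣ m - 1 then m - 4 else 0) := by
  have hp' := Nat.prime_iff_prime_int.mp hp
  have hodd : Odd p := ⟨N, hN⟩
  have fermat {x : ℤ} (hx : ¬ (p : ℤ) ∣ x) : (p : ℤ) ∣ (x ^ 2) ^ N - 1 := by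
    rw [← pow_mul, show 2 * N = p - 1 by omega]
    exact (Int.ModEq.pow_card_sub_one_eq_one hp
      ((hp'.coprime_iff_not_dvd.mpr hx).symm)).symm.dvd
  obtain ⟨n, hn, c, hc⟩ := sq_dvd_pow_half_sub hN hδ h1 b
  obtain ⟨n', hn', d, hd⟩ := sq_dvd_pow_half_sub hN (fermat hm) (Or.inr (Or.inl rfl)) b
  obtain rfl : n = n' := by omega
  obtain ⟨z, hz⟩ := sq_dvd_sum_choose_sub hp m hn
  have hM : m ^ (p ^ (b + 1) - 1) = (m ^ 2) ^ n := by
    rw [hn, add_tsub_cancel_right, pow_mul]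
  obtain ⟨f, hf⟩ := fermat hm
  rw [one_pow, one_mul] at hd
  rw [show p - 1 = 2 * N by omega]
  have hthree (h : p ^ (b + 1) = 3) : p = 3 ∧ b = 0 := by
    have h2 : p = 3 := (Nat.prime_dvd_prime_iff_eq hp Nat.prime_three).mp
      (h ▸ dvd_pow_self p b.succ_ne_zero)
    subst h2
    exact ⟨rfl, by
      simpa using Nat.pow_right_injective (by norm_num) (h.trans (pow_one 3).symm)⟩
  by_cases h0 : δ = 0
  · subst h0
    rw [sub_zero] at hδ
    have h4 := prime_dvd_sub_four hp hm hδ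
    cases b with
    | succ b =>
      obtain ⟨x, hx⟩ := sq_dvd_lucasU_prime_pow hp hN hδ b.succ_ne_zero
      rw [if_neg fun h => absurd (hthree h.1).2 b.succ_ne_zero, zero_pow (Nat.succ_ne_zero _),
        zero_pow (Nat.succ_ne_zero _)]
      rw [zero_pow (Nat.succ_ne_zero _)] at hc
      exact ⟨2 * z + 4 * c - 2 * x, by linear_combination 2 * hz + 4 * hc - 2 * hx⟩
    | zero =>
      obtain ⟨x, hx⟩ := dvd_lucasU_prime hp hN hδ
      obtain ⟨y, hy⟩ := h4
      obtain rfl : n = N := by rw [zero_add, pow_one] at hn; omega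
      -- As p ∣ m-4, Δ^n is divisible by p² once n ≥ 2. For n = 1, p = 3 the sum is 2m(m-4)(m+2),
      -- with 3 dividing both m-4 and m+2.
      have hε : (p : ℤ) ^ 2 ∣ 4 * (m * (m - 4)) ^ n
          + 2 * (m ^ 2) ^ n * if p ^ (0 + 1) = 3 ∧ 3 ∣ m - 1 then m - 4 else 0 := by
        by_cases h3 : p = 3
        · subst h3
          obtain rfl : n = 1 := by omega
          push_cast at hy ⊢
          rw [if_pos ⟨by norm_num, by omega⟩, pow_one, pow_one]
          exact ⟨2 * m * y * (y + 2), by linear_combination (2 * m * (m + 2) + 6 * m * y) * hy⟩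
        · rw [if_neg fun h => h3 (by simpa using h.1), mul_zero, add_zero]
          refine Dvd.dvd.mul_left (dvd_trans (pow_dvd_pow_of_dvd ?_ 2) (pow_dvd_pow _ ?_)) _
          · exact Dvd.intro _ hy.symm |>.mul_left m
          · have := hp.two_le
            omega
      obtain ⟨g, hg⟩ := hε
      rw [hM]
      simp only [zero_add, pow_one, pow_zero, one_mul, sub_zero, Int.toNat_natCast, mul_zero,
        zero_mul, add_zero] at *
      refine ⟨2 * z + g + (m - 2) * f * x + y * x, ?_⟩
      linear_combination 2 * hz + hg + (m - 2) * lucasU (m - 2) 1 p * hf + (m - 2) * p * f * hx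
        + lucasU (m - 2) 1 p * hy + p * y * hx
  · have h1 := h1.resolve_left h0
    have hsq : δ ^ 2 = 1 := by rcases h1 with rfl | rfl <;> norm_num
    have hif : ¬ (p ^ (b + 1) = 3 ∧ 3 ∣ m - 1) := by
      rintro ⟨h3, h3'⟩
      obtain ⟨rfl, -⟩ := hthree h3
      obtain rfl : N = 1 := by omega
      have : (3 : ℤ) ∣ m * (m - 4) := Dvd.dvd.mul_left (by omega) _
      rw [pow_one] at hδ
      push_cast at hδ
      omega
    rw [if_neg hif, hM]
    obtain ⟨x1, hx1⟩ := (lucasU_prime_pow_modEq hp hN hδ h1 b).1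
    obtain ⟨⟨y1, hy1⟩, ⟨y2, hy2⟩, -⟩ := lucasU_prime_modEq hp hN hδ h1
    obtain ⟨w, hw⟩ := two_mul_pow_half_sub hδ hsq
    rw [mul_pow _ _ (2 * N), pow_mul m 2 N] at hw
    rw [pow_succ δ]
    generalize lucasU (m - 2) 1 ((p : ℤ) - δ).toNat = X at *
    generalize lucasU (m - 2) 1 (p ^ (b + 1)) = un at *
    generalize lucasU (m - 2) 1 p = u at *
    generalize δ ^ b = e at *
    generalize (m ^ 2) ^ n = M at *
    generalize (m ^ 2) ^ N = M0 at *
    generalize (m - 4) ^ (2 * N) = K at *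
    generalize (m * (m - 4)) ^ N = E at *
    refine ⟨2 * z + 4 * c - 2 * x1 - e * y2 + 2 * e * w + (m - 2) * e * f * y1
      - (e * (2 - m) * X + 2 * e * δ * K) * d, ?_⟩
    linear_combination 2 * hz + 4 * hc - 2 * hx1 - e * hy2 + 2 * e * hw
      + (m - 2) * e * (X * hf + p * f * hy1) - (e * (2 - m) * X + 2 * e * δ * K) * hd

/-! ### Passage to ℤ_p and general h -/

theorem prime_dvd_pow_sub_jacobiSym {p N : ℕ} [Fact p.Prime] (hN : p = 2 * N + 1) (x : ℤ) :
    (p : ℤ) ∣ x ^ N - jacobiSym x p := by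
  rw [← Int.modEq_iff_dvd, ← ZMod.intCast_eq_intCast_iff, ← jacobiSym.legendreSym.to_jacobiSym,
    legendreSym.eq_pow, show p / 2 = N by omega]
  push_cast
  rfl

theorem PadicInt.coe_ofNat {p : ℕ} [Fact p.Prime] (n : ℕ) [n.AtLeastTwo] :
    ((ofNat(n) : ℤ_[p]) : ℚ_[p]) = ofNat(n) := rfl

theorem PadicInt.isUnit_intCast {p : ℕ} [Fact p.Prime] {x : ℤ} (hx : ¬ (p : ℤ) ∣ x) :
    IsUnit (x : ℤ_[p]) := by
  rw [PadicInt.isUnit_iff]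
  exact le_antisymm (PadicInt.norm_le_one _)
    (not_lt.mp fun h => hx ((PadicInt.norm_int_lt_one_iff_dvd x).mp h))

/-- Denominators are cleared by 2m^(n-1), a unit of ℤ_p. -/
theorem padicModEq_of_sq_dvd {p : ℕ} [Fact p.Prime] (hodd : Odd p) {m : ℤ} (hm : ¬ (p : ℤ) ∣ m)
    (n : ℕ) (f : ℕ → ℤ_[p]) (R : ℤ_[p])
    (h : (p : ℤ_[p]) ^ 2 ∣ 2 * ∑ k ∈ range n, (-1) ^ k * f k
      * (((2 * k).choose k : ℤ_[p]) * (m : ℤ_[p]) ^ (n - 1 - k)) - (m : ℤ_[p]) ^ (n - 1) * R) :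
    PadicModEq p 2 (∑ k ∈ range n, (f k : ℚ_[p]) * (((2 * k).choose k : ℚ_[p]) / (-(m : ℚ_[p])) ^ k))
      ((R : ℚ_[p]) / 2) := by
  obtain ⟨c, hc⟩ := h
  have h2 : ¬ (p : ℤ) ∣ 2 := fun h => by
    have := (isCoprime_sq_two_pow hodd 1).of_isCoprime_of_dvd_left (dvd_pow_self _ two_ne_zero)
    rw [pow_one] at this
    exact (Nat.prime_iff_prime_int.mp (Fact.out : p.Prime)).not_isUnit (this.isUnit_of_dvd' dvd_rfl h)
  obtain ⟨u, hu⟩ := (PadicInt.isUnit_intCast h2).mul ((PadicInt.isUnit_intCast hm).pow (n - 1))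
  have hm0 : (m : ℚ_[p]) ≠ 0 := by
    rw [Int.cast_ne_zero]
    rintro rfl
    simp at hm
  refine ⟨c * (u⁻¹ : ℤ_[p]ˣ), ?_⟩
  have hu' : (((u⁻¹ : ℤ_[p]ˣ) : ℤ_[p]) : ℚ_[p]) * (2 * (m : ℚ_[p]) ^ (n - 1)) = 1 := by
    have := congrArg (fun t : ℤ_[p] => (t : ℚ_[p])) (u.inv_mul)
    rw [hu] at this
    simpa [PadicInt.coe_ofNat] using this
  have hs : (∑ k ∈ range n, (f k : ℚ_[p]) * (((2 * k).choose k : ℚ_[p]) / (-(m : ℚ_[p])) ^ k))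
      * (m : ℚ_[p]) ^ (n - 1) = ∑ k ∈ range n, (-1) ^ k * (f k : ℚ_[p])
      * (((2 * k).choose k : ℚ_[p]) * (m : ℚ_[p]) ^ (n - 1 - k)) := by
    rw [sum_mul]
    refine sum_congr rfl fun k hk => ?_
    have hk : k < n := by simpa using hk
    have hs : ((-1 : ℚ_[p]) ^ k) * (-1) ^ k = 1 := by rw [← mul_pow]; simp
    rw [show n - 1 = (n - 1 - k) + k by omega, add_tsub_cancel_right, pow_add, neg_pow]
    field_simp
    linear_combination -(f k : ℚ_[p]) * ((2 * k).choose k) * hs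
  have hc' := congrArg (fun t : ℤ_[p] => (t : ℚ_[p])) hc
  have hcoe : ((∑ k ∈ range n, (-1) ^ k * f k
      * (((2 * k).choose k : ℤ_[p]) * (m : ℤ_[p]) ^ (n - 1 - k)) : ℤ_[p]) : ℚ_[p])
      = ∑ k ∈ range n, (-1) ^ k * (f k : ℚ_[p])
      * (((2 * k).choose k : ℚ_[p]) * (m : ℚ_[p]) ^ (n - 1 - k)) := by
    rw [PadicInt.coe_sum]
    push_cast
    rfl
  push_cast [hcoe, PadicInt.coe_ofNat] at hc' ⊢
  rw [← hs] at hc'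
  generalize (∑ k ∈ range n, (f k : ℚ_[p]) * (((2 * k).choose k : ℚ_[p]) / (-(m : ℚ_[p])) ^ k)) = S
    at *
  linear_combination (((u⁻¹ : ℤ_[p]ˣ) : ℤ_[p]) : ℚ_[p]) * hc' + (R / 2 - S) * hu'

theorem sq_dvd_two_mul_sum_ringChoose_sub {p N : ℕ} [Fact p.Prime] (hN : p = 2 * N + 1) {m δ : ℤ}
    (hm : ¬ (p : ℤ) ∣ m) (hδ : (p : ℤ) ∣ (m * (m - 4)) ^ N - δ) (h1 : δ = 0 ∨ δ = 1 ∨ δ = -1)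
    (b : ℕ) (h : ℤ_[p]) :
    (p : ℤ_[p]) ^ 2 ∣ 2 * ∑ k ∈ range (p ^ (b + 1)),
        (-1) ^ k * Ring.choose (h * (p : ℤ_[p]) ^ (b + 1) - 1) k
          * (((2 * k).choose k : ℤ_[p]) * (m : ℤ_[p]) ^ (p ^ (b + 1) - 1 - k))
      - (m : ℤ_[p]) ^ (p ^ (b + 1) - 1) * ((δ : ℤ_[p]) ^ b * (2 - h * m)
          * (lucasU (m - 2) 1 ((p : ℤ) - δ).toNat : ℤ_[p])
        + 2 * (δ : ℤ_[p]) ^ (b + 1) * (1 + h * (((m : ℤ_[p]) - 4) ^ (p - 1) - 1))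
        - 2 * h * ((if p ^ (b + 1) = 3 ∧ 3 ∣ m - 1 then m - 4 else 0 : ℤ) : ℤ_[p])) := by
  have hp : p.Prime := Fact.out
  obtain ⟨c, hc⟩ := sq_dvd_sum_centralBinom_mul_pow_sub hp hN hm hδ h1 b
  obtain ⟨d, hd⟩ := sq_dvd_two_mul_sum_choose_sub hp hN hm hδ h1 b
  generalize (if p ^ (b + 1) = 3 ∧ 3 ∣ m - 1 then m - 4 else 0 : ℤ) = ε at *
  have e1 := choose_pow_sub_one_signed p (b + 1) 1
  simp only [Nat.cast_one, one_mul] at e1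
  have hlin : (p : ℤ_[p]) ^ 2 ∣ ∑ k ∈ range (p ^ (b + 1)),
      ((-1) ^ k * Ring.choose (h * (p : ℤ_[p]) ^ (b + 1) - 1) k
        - (1 + h * ((-1) ^ k * ((p ^ (b + 1) - 1).choose k : ℤ_[p]) - 1)))
          * (((2 * k).choose k : ℤ_[p]) * (m : ℤ_[p]) ^ (p ^ (b + 1) - 1 - k)) := by
    refine dvd_sum fun k hk => Dvd.dvd.mul_right ?_ _
    rw [← e1 k one_pos]
    exact PadicInt.sq_dvd_signed_choose_sub h (by simpa using hk)
  have hsplit : ∑ k ∈ range (p ^ (b + 1)),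
      ((-1) ^ k * Ring.choose (h * (p : ℤ_[p]) ^ (b + 1) - 1) k
        - (1 + h * ((-1) ^ k * ((p ^ (b + 1) - 1).choose k : ℤ_[p]) - 1)))
          * (((2 * k).choose k : ℤ_[p]) * (m : ℤ_[p]) ^ (p ^ (b + 1) - 1 - k))
      = ∑ k ∈ range (p ^ (b + 1)), (-1) ^ k * Ring.choose (h * (p : ℤ_[p]) ^ (b + 1) - 1) k
          * (((2 * k).choose k : ℤ_[p]) * (m : ℤ_[p]) ^ (p ^ (b + 1) - 1 - k))
        - (1 - h) * ∑ k ∈ range (p ^ (b + 1)),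
          ((2 * k).choose k : ℤ_[p]) * (m : ℤ_[p]) ^ (p ^ (b + 1) - 1 - k)
        - h * ∑ k ∈ range (p ^ (b + 1)), (-1) ^ k * ((p ^ (b + 1) - 1).choose k : ℤ_[p])
          * (((2 * k).choose k : ℤ_[p]) * (m : ℤ_[p]) ^ (p ^ (b + 1) - 1 - k)) := by
    rw [mul_sum, mul_sum, ← sum_sub_distrib, ← sum_sub_distrib]
    exact sum_congr rfl fun k _ => by ring
  rw [hsplit] at hlin
  obtain ⟨f, hf⟩ := hlin
  replace hc := congrArg (fun t : ℤ => (t : ℤ_[p])) hc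
  replace hd := congrArg (fun t : ℤ => (t : ℤ_[p])) hd
  push_cast at hc hd
  exact ⟨2 * f + 2 * (1 - h) * c + h * d,
    by linear_combination 2 * hf + 2 * (1 - h) * hc + h * hd⟩

theorem prime_dvd_lucasU_sub {p N : ℕ} (hp : p.Prime) (hN : p = 2 * N + 1) {m δ : ℤ}
    (hδ : (p : ℤ) ∣ (m * (m - 4)) ^ N - δ) (h1 : δ = 0 ∨ δ = 1 ∨ δ = -1) :
    (p : ℤ) ∣ lucasU (m - 2) 1 ((p : ℤ) - δ).toNat := by
  by_cases h0 : δ = 0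
  · subst h0
    simpa using dvd_lucasU_prime hp hN (by simpa using hδ)
  · exact (lucasU_prime_modEq hp hN hδ (h1.resolve_left h0)).1

end

theorem theorem1p2 (p : ℕ) [Fact p.Prime] (hp : Odd p) (a : ℕ) (ha : 0 < a)
    (m : ℤ) (hm : ¬ (p : ℤ) ∣ m) (Δ : ℤ) (hΔ : Δ = m * (m - 4)) (h : ℤ_[p]) :
    PadicModEq p 2
      (∑ k ∈ Finset.range (p ^ a),
        ((Ring.choose (h * (p : ℤ_[p]) ^ a - 1) k : ℤ_[p]) : ℚ_[p]) *
          (((2 * k).choose k : ℚ_[p]) / (-(m : ℚ_[p])) ^ k))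
      ((jacobiSym Δ (p ^ (a - 1)) : ℚ_[p]) * (1 - (h : ℚ_[p]) * (m : ℚ_[p]) / 2) *
          (lucasU (m - 2) 1 ((p : ℤ) - jacobiSym Δ p).toNat : ℚ_[p])
        + (jacobiSym Δ (p ^ a) : ℚ_[p]) *
          (1 + (h : ℚ_[p]) * (((m : ℚ_[p]) - 4) ^ (p - 1) - 1))
        - (if p ^ a = 3 ∧ (3 : ℤ) ∣ m - 1 then (h : ℚ_[p]) * ((m : ℚ_[p]) - 4) else 0)) ∧
    ((p : ℤ_[p]) ∣ h * (m : ℤ_[p]) - 2 →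
      PadicModEq p 2
        (∑ k ∈ Finset.range (p ^ a),
          ((Ring.choose (h * (p : ℤ_[p]) ^ a - 1) k : ℤ_[p]) : ℚ_[p]) *
            (((2 * k).choose k : ℚ_[p]) / (-(m : ℚ_[p])) ^ k))
        ((jacobiSym Δ (p ^ a) : ℚ_[p]) *
            (1 + (h : ℚ_[p]) * (((m : ℚ_[p]) - 4) ^ (p - 1) - 1))
          + (if p ^ a = 3 ∧ (3 : ℤ) ∣ m - 1 then (m : ℚ_[p]) - 4 else 0))) := by
  obtain ⟨N, hN⟩ := hp
  obtain ⟨b, rfl⟩ := Nat.exists_eq_succ_of_ne_zero ha.ne'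
  subst hΔ
  have hprime : p.Prime := Fact.out
  have hδ := prime_dvd_pow_sub_jacobiSym hN (m * (m - 4))
  have h1 := jacobiSym.trichotomy (m * (m - 4)) p
  -- For b = 0 and δ = 0, the value 0^0 = 1 agrees with the symbol at modulus 1.
  rw [jacobiSym.pow_right, jacobiSym.pow_right, Nat.succ_eq_add_one, add_tsub_cancel_right]
  generalize jacobiSym (m * (m - 4)) p = δ at *
  have key := sq_dvd_two_mul_sum_ringChoose_sub hN hm hδ h1 b h
  refine ⟨?_, fun hh => ?_⟩
  · have := padicModEq_of_sq_dvd ⟨N, hN⟩ hm _ _ _ key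
    convert this using 1
    split_ifs
    · push_cast [PadicInt.coe_ofNat]
      ring
    · push_cast [PadicInt.coe_ofNat]
      ring
  · have key2 : (p : ℤ_[p]) ^ 2 ∣ ((δ : ℤ_[p]) ^ b * (2 - h * m)
          * (lucasU (m - 2) 1 ((p : ℤ) - δ).toNat : ℤ_[p])
        + 2 * (δ : ℤ_[p]) ^ (b + 1) * (1 + h * (((m : ℤ_[p]) - 4) ^ (p - 1) - 1))
        - 2 * h * ((if p ^ (b + 1) = 3 ∧ 3 ∣ m - 1 then m - 4 else 0 : ℤ) : ℤ_[p]))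
        - (2 * (δ : ℤ_[p]) ^ (b + 1) * (1 + h * (((m : ℤ_[p]) - 4) ^ (p - 1) - 1))
        + 2 * ((if p ^ (b + 1) = 3 ∧ 3 ∣ m - 1 then m - 4 else 0 : ℤ) : ℤ_[p])) := by
      obtain ⟨x, hx⟩ := prime_dvd_lucasU_sub hprime hN hδ h1
      obtain ⟨y, hy⟩ := hh
      have hx' := congrArg (fun t : ℤ => (t : ℤ_[p])) hx
      push_cast at hx'
      split_ifs with h3
      · have hp3 : p = 3 := (Nat.prime_dvd_prime_iff_eq hprime Nat.prime_three).mp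
          (h3.1 ▸ dvd_pow_self p b.succ_ne_zero)
        obtain ⟨z, hz⟩ := h3.2
        replace hz := congrArg (fun t : ℤ => (t : ℤ_[p])) hz
        have hp3' : (p : ℤ_[p]) = 3 := by exact_mod_cast congrArg (Nat.cast : ℕ → ℤ_[p]) hp3
        push_cast at hz ⊢
        rw [hp3'] at hx' hy ⊢
        -- Here m ≡ 1 and hm ≡ 2 modulo 3, so h ≡ -1 and 9 divides (h+1)(m-4): -h(m-4) may be
        -- replaced by m-4.
        refine ⟨-(δ : ℤ_[p]) ^ b * y * x - 2 * (y - h * z + 1) * (z - 1), ?_⟩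
        linear_combination -(δ : ℤ_[p]) ^ b * (lucasU (m - 2) 1 ((p : ℤ) - δ).toNat) * hy
          - 3 * (δ : ℤ_[p]) ^ b * y * hx' - 2 * (m - 4) * (hy - h * hz)
          - 2 * (3 * y - h * 3 * z + 3) * hz
      · refine ⟨-(δ : ℤ_[p]) ^ b * y * x, ?_⟩
        push_cast
        linear_combination -(δ : ℤ_[p]) ^ b * (lucasU (m - 2) 1 ((p : ℤ) - δ).toNat) * hy
          - p * (δ : ℤ_[p]) ^ b * y * hx'
    obtain ⟨s, hs⟩ := key
    obtain ⟨t, ht⟩ := key2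
    have := padicModEq_of_sq_dvd ⟨N, hN⟩ hm (p ^ (b + 1))
      (fun k => Ring.choose (h * (p : ℤ_[p]) ^ (b + 1) - 1) k)
      (2 * (δ : ℤ_[p]) ^ (b + 1) * (1 + h * (((m : ℤ_[p]) - 4) ^ (p - 1) - 1))
        + 2 * ((if p ^ (b + 1) = 3 ∧ 3 ∣ m - 1 then m - 4 else 0 : ℤ) : ℤ_[p]))
      ⟨s + (m : ℤ_[p]) ^ (p ^ (b + 1) - 1) * t,
        by linear_combination hs + (m : ℤ_[p]) ^ (p ^ (b + 1) - 1) * ht⟩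
    convert this using 1
    split_ifs
    · push_cast [PadicInt.coe_ofNat]
      ring
    · push_cast [PadicInt.coe_ofNat]
      ring
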